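/- Let $F$ be a free group of finite rank at least $2$. A \emph{subgroup system} is a nonempty finite collection of subgroups of $F$, called its components. A \emph{free factor system} is either the trivial system $\{1\}$, whose only component is the trivial subgroup, or a nonempty finite collection $\{A_1,\dots,A_l\}$ of nontrivial subgroups such that $\langle A_1,\dots,A_l\rangle$ is the free product $A_1*\cdots*A_l$ and is a free factor of $F$. A system $\mathcal A$ \emph{carries} a system $\mathcal B$ if every $B\in\mathcal B$ satisfies $B\le xAx^{-1}$ for some $A\in\mathcal A$ and $x\in F$; for free factor systems one writes $\mathcal B\preceq\mathcal A$. This is a preorder, and free factor systems are called equivalent if each carries the other. For an endomorphism $\phi$ of $F$ put $\phi(\mathcal A)=\{\phi(A):A\in\mathcal A\}$. The system $\mathcal A$ is \emph{$[\phi]$-invariant} if $\mathcal A$ carries $\phi(\mathcal A)$, and \emph{$[\phi]$-fixed} if there is a permutation $\sigma$ of its components such that $\phi(A)$ is conjugate to $\sigma(A)$ for every $A\in\mathcal A$. Let $\phi:F\to F$ be an injective endomorphism and let $\mathcal A$ be a $\preceq$-maximal $[\phi]$-fixed free factor system. Then among the $[\phi]$-invariant free factor systems $\mathcal B\succeq\mathcal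 A$ such that $\phi^k(\mathcal B)$ is carried by $\mathcal A$ for some $k\ge 0$ there is a maximal one $\mathcal A^*$ with respect to $\preceq$; it carries all the others, and it is the unique maximal one up to equivalence (the $[\phi]$-elliptic free factor system). Moreover, for every such maximal $\mathcal A^*$, one can replace each component of $\mathcal A$ with a conjugate so that the result is again a free factor system and $\mathcal A\subset\mathcal A^*$. -/

import Mathlib

namespace FreeFactor

variable {F : Type*} [Group F]

/-- The conjugate `x A x⁻¹` of a subgroup. -/
def conjBy (x : F) (A : Subgroup F) : Subgroup F :=
  A.map (MulAut.conj x).toMonoidHom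

/-- `A` is a free factor of `F`: `F` is the internal free product of `A` and some subgroup `B`. -/
def IsFreeFactor (A : Subgroup F) : Prop :=
  ∃ B : Subgroup F, Function.Bijective (Monoid.Coprod.lift A.subtype B.subtype)

/-- A nontrivial free factor system: a nonempty finite collection of nontrivial subgroups which
generate their free product, this free product being a free factor of `F`. Each component is
then itself a free factor, and distinct components intersect trivially. -/
structure IsNontrivialFreeFactorSystem (𝒜 : Set (Subgroup F)) : Prop where
  finite : 𝒜.Finite
  nonempty : 𝒜.Nonempty
  ne_bot : ∀ A ∈ 𝒜, A ≠ ⊥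
  freeProduct : Function.Injective (Monoid.CoprodI.lift fun A : 𝒜 => (A : Subgroup F).subtype)
  freeFactor : IsFreeFactor (sSup 𝒜)

/-- A free factor system is the trivial system, whose only component is the trivial subgroup,
or a nontrivial free factor system. -/
def IsFreeFactorSystem (𝒜 : Set (Subgroup F)) : Prop :=
  𝒜 = {⊥} ∨ IsNontrivialFreeFactorSystem 𝒜

/-- `𝒜` carries `ℬ`: each component of `ℬ` lies in a conjugate of a component of `𝒜`.
For free factor systems this is the relation `ℬ ⪯ 𝒜`. -/
def Carries (𝒜 ℬ : Set (Subgroup F)) : Prop :=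
  ∀ B ∈ ℬ, ∃ A ∈ 𝒜, ∃ x : F, B ≤ conjBy x A

/-- Equivalence of systems for the preorder `⪯`. -/
def SystemEquiv (𝒜 ℬ : Set (Subgroup F)) : Prop :=
  Carries 𝒜 ℬ ∧ Carries ℬ 𝒜

/-- The system `φ(𝒜) = {φ(A) : A ∈ 𝒜}`; its iterates are the systems `φ^k(𝒜)`. -/
def mapSystem (φ : F →* F) (𝒜 : Set (Subgroup F)) : Set (Subgroup F) :=
  Subgroup.map φ '' 𝒜

/-- `𝒜` is `[φ]`-invariant. -/
def IsInvariant (φ : F →* F) (𝒜 : Set (Subgroup F)) : Prop :=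
  Carries 𝒜 (mapSystem φ 𝒜)

/-- `𝒜` is `[φ]`-fixed: `φ` permutes the components of `𝒜` up to conjugacy. -/
def IsFixed (φ : F →* F) (𝒜 : Set (Subgroup F)) : Prop :=
  ∃ σ : Equiv.Perm 𝒜, ∀ A : 𝒜, ∃ x : F,
    (A : Subgroup F).map φ = conjBy x (σ A : Subgroup F)

/-- `𝒜` is a maximal `[φ]`-fixed free factor system, with respect to `⪯`. -/
structure IsMaximalFixed (φ : F →* F) (𝒜 : Set (Subgroup F)) : Prop where
  system : IsFreeFactorSystem 𝒜
  fixed : IsFixed φ 𝒜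
  maximal : ∀ ℬ : Set (Subgroup F), IsFreeFactorSystem ℬ → IsFixed φ ℬ →
    Carries ℬ 𝒜 → Carries 𝒜 ℬ

/-- `ℬ` is a `[φ]`-invariant free factor system with `𝒜 ⪯ ℬ` such that `φ^k(ℬ)` is carried by
`𝒜` for some `k ≥ 0`. -/
structure IsEventuallyCarried (φ : F →* F) (𝒜 ℬ : Set (Subgroup F)) : Prop where
  system : IsFreeFactorSystem ℬ
  invariant : IsInvariant φ ℬ
  carries : Carries ℬ 𝒜
  eventually : ∃ k : ℕ, Carries 𝒜 ((mapSystem φ)^[k] ℬ)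

/-- `ℰ` is maximal, with respect to `⪯`, among the `[φ]`-invariant free factor systems `ℬ ⪰ 𝒜`
such that `φ^k(ℬ)` is carried by `𝒜` for some `k ≥ 0`. -/
structure IsElliptic (φ : F →* F) (𝒜 ℰ : Set (Subgroup F)) : Prop where
  eventuallyCarried : IsEventuallyCarried φ 𝒜 ℰ
  maximal : ∀ ℬ : Set (Subgroup F), IsEventuallyCarried φ 𝒜 ℬ → Carries ℬ ℰ → Carries ℰ ℬ

/-- `𝒜'` is obtained from `𝒜` by replacing each component with a conjugate. -/
def IsConjugateReplacement (𝒜 𝒜' : Set (Subgroup F)) : Prop :=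
  ∃ e : 𝒜 ≃ 𝒜', ∀ A : 𝒜, ∃ x : F, (e A : Subgroup F) = conjBy x (A : Subgroup F)

end FreeFactor

open FreeFactor

/-! For nontrivial `𝒜`, pull `𝒜` back along each `φ^k`. By the Kurosh subgroup theorem
(`FreeDecomp.exists_pullback`) the nontrivial preimages of conjugates of components are, up to
conjugacy, the components `𝒮 k` of a free decomposition of `F`. A subgroup is carried by `𝒮 k`
exactly when its image under `φ^k` is carried by `𝒜`. As `φ` permutes `𝒜` up to conjugacy, the `𝒮 k`
ascend.

The chain stabilizes (`exists_stable_of_ascending`). Two finite invariants detect this: the set of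
homomorphisms `F → ℤ/2` that kill the system, and the number of components. When neither drops,
`FreeDecomp.carries_of_kills` gives equivalence. A stable `𝒮 k` is eventually carried and carries
every other eventually carried system, which gives existence and uniqueness.

For the last claim, let `A ≤ xEx⁻¹` with `E` in an eventually carried system. A suitable `φ^k`
squeezes `φ^k(xEx⁻¹)` between conjugates of two components of `𝒜`. These must coincide
(`FreeDecomp.eq_of_le_conjBy`), so `A = xEx⁻¹` by injectivity. -/

namespace FreeFactor

universe u

/-! ### Conjugates of subgroups and the carrying relation. -/

section Conj

variable {F : Type*} [Group F]

theorem mem_conjBy {x g : F} {A : Subgroup F} : g ∈ conjBy x A ↔ x⁻¹ * g * x ∈ A := by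
  constructor
  · rintro ⟨a, ha, rfl⟩
    simpa [mul_assoc] using ha
  · intro h
    exact ⟨_, h, by simp [mul_assoc]⟩

theorem conjBy_conjBy (x y : F) (A : Subgroup F) : conjBy x (conjBy y A) = conjBy (x * y) A := by
  ext g
  simp [mem_conjBy, mul_assoc]

@[simp]
theorem conjBy_one (A : Subgroup F) : conjBy 1 A = A := by
  ext g
  simp [mem_conjBy]

theorem conjBy_mono (x : F) {A B : Subgroup F} (h : A ≤ B) : conjBy x A ≤ conjBy x B :=
  Subgroup.map_mono h

theorem map_conjBy {L : Type*} [Group L] (φ : F →* L) (x : F) (A : Subgroup F) :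
    (conjBy x A).map φ = conjBy (φ x) (A.map φ) := by
  simp only [conjBy, Subgroup.map_map]
  congr 1
  ext g
  simp

theorem conjBy_of_mem {x : F} {A : Subgroup F} (hx : x ∈ A) : conjBy x A = A := by
  ext g
  rw [mem_conjBy, A.mul_mem_cancel_right hx, A.mul_mem_cancel_left (inv_mem hx)]

theorem conjBy_comap {L : Type*} [Group L] (ψ : L →* F) (l : L) (A : Subgroup F) :
    conjBy l (A.comap ψ) = (conjBy (ψ l) A).comap ψ := by
  ext g
  simp [mem_conjBy]

/-- The agreement locus is a subgroup, so when `B` is a join the hypothesis can be checked on each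
piece separately. -/
theorem hom_eq_of_le_map_eqLocus {K : Type*} [Group K] {B : Subgroup F} {f : F →* K} {g : B →* K}
    (hle : B ≤ ((f.comp B.subtype).eqLocus g).map B.subtype) (p : B) : f p = g p := by
  obtain ⟨q, hq, hqp⟩ := hle p.2
  obtain rfl : q = p := Subtype.ext hqp
  exact hq

@[simp]
theorem conjBy_bot (x : F) : conjBy x (⊥ : Subgroup F) = ⊥ :=
  Subgroup.map_bot _

theorem Carries.trans {𝒜 ℬ 𝒞 : Set (Subgroup F)} (h : Carries 𝒜 ℬ) (h' : Carries ℬ 𝒞) :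
    Carries 𝒜 𝒞 := by
  intro C hC
  obtain ⟨B, hB, x, hx⟩ := h' C hC
  obtain ⟨A, hA, y, hy⟩ := h B hB
  exact ⟨A, hA, x * y, hx.trans (by rw [← conjBy_conjBy]; exact conjBy_mono x hy)⟩

end Conj

/-! ### Internal free decompositions and their universal property. -/

/-- `F` is the internal free product of the components of `𝒮` and of `B`. -/
def FreeDecomp {F : Type*} [Group F] (𝒮 : Set (Subgroup F)) (B : Subgroup F) : Prop :=
  Function.Bijective
    (Monoid.Coprod.lift (Monoid.CoprodI.lift fun P : 𝒮 => (P : Subgroup F).subtype) B.subtype)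

section FreeDecomp

variable {F : Type*} [Group F] {𝒮 : Set (Subgroup F)} {B : Subgroup F}

theorem range_lift_subtype (𝒮 : Set (Subgroup F)) :
    (Monoid.CoprodI.lift fun P : 𝒮 => (P : Subgroup F).subtype).range = sSup 𝒮 := by
  rw [Monoid.CoprodI.range_eq_iSup, sSup_eq_iSup']
  simp

theorem FreeDecomp.sup_eq_top (h : FreeDecomp 𝒮 B) : sSup 𝒮 ⊔ B = ⊤ := by
  have := MonoidHom.range_eq_top.2 h.2
  rwa [Monoid.Coprod.range_lift, range_lift_subtype, Subgroup.range_subtype] at this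

/-- Generation gives surjectivity, and `f` is a left inverse of the canonical map. This avoids all
normal forms. -/
theorem freeDecomp_of_hom (hgen : sSup 𝒮 ⊔ B = ⊤)
    (f : F →* Monoid.Coprod (Monoid.CoprodI fun P : 𝒮 => (P : Subgroup F)) B)
    (hf : ∀ (P : 𝒮) (p : (P : Subgroup F)), f p = Monoid.Coprod.inl
      (Monoid.CoprodI.of (M := fun P : 𝒮 => (P : Subgroup F)) (i := P) p))
    (hB : ∀ p : B, f p = Monoid.Coprod.inr p) : FreeDecomp 𝒮 B := by
  constructor
  · have : f.comp (Monoid.Coprod.lift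
        (Monoid.CoprodI.lift fun P : 𝒮 => (P : Subgroup F).subtype) B.subtype) =
        MonoidHom.id _ := by
      refine Monoid.Coprod.hom_ext ?_ ?_
      · refine Monoid.CoprodI.ext_hom _ _ fun P => ?_
        ext p
        simpa using hf P p
      · ext p
        simpa using hB p
    exact Function.LeftInverse.injective (g := f) fun x => DFunLike.congr_fun this x
  · rw [← MonoidHom.range_eq_top, Monoid.Coprod.range_lift, range_lift_subtype,
      Subgroup.range_subtype, hgen]

theorem FreeDecomp.exists_hom (h : FreeDecomp 𝒮 B) {K : Type*} [Group K]
    (g : ∀ P : 𝒮, (P : Subgroup F) →* K) (gB : B →* K) :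
    ∃ f : F →* K, (∀ (P : 𝒮) (p : (P : Subgroup F)), f p = g P p) ∧ ∀ p : B, f p = gB p := by
  let e := MulEquiv.ofBijective _ h
  have he : ∀ x, e x = Monoid.Coprod.lift
    (Monoid.CoprodI.lift fun P : 𝒮 => (P : Subgroup F).subtype) B.subtype x := fun _ => rfl
  refine ⟨(Monoid.Coprod.lift (Monoid.CoprodI.lift g) gB).comp e.symm.toMonoidHom, ?_, ?_⟩
  · intro P p
    have : e.symm p = Monoid.Coprod.inl
        (Monoid.CoprodI.of (M := fun P : 𝒮 => (P : Subgroup F)) (i := P) p) := by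
      rw [MulEquiv.symm_apply_eq]
      simp [he]
    simp [this]
  · intro p
    have : e.symm p = Monoid.Coprod.inr p := by
      rw [MulEquiv.symm_apply_eq]
      simp [he]
    simp [this]

theorem FreeDecomp.isFreeFactor (h : FreeDecomp 𝒮 B) : IsFreeFactor (sSup 𝒮) := by
  refine ⟨B, ?_, ?_⟩
  · let κ : Monoid.CoprodI (fun P : 𝒮 => (P : Subgroup F)) →*
        (sSup 𝒮 : Subgroup F) :=
      (Monoid.CoprodI.lift fun P : 𝒮 => (P : Subgroup F).subtype).codRestrict (sSup 𝒮) fun x => by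
        rw [← range_lift_subtype]
        exact ⟨x, rfl⟩
    have hκ : Function.Surjective κ := by
      rintro ⟨x, hx⟩
      rw [← range_lift_subtype] at hx
      obtain ⟨y, hy⟩ := hx
      exact ⟨y, Subtype.ext hy⟩
    have hs : Function.Surjective (Monoid.Coprod.map κ (MonoidHom.id B)) := by
      rw [← MonoidHom.range_eq_top, Monoid.Coprod.range_eq, Monoid.Coprod.map_comp_inl,
        Monoid.Coprod.map_comp_inr,
        MonoidHom.range_comp, MonoidHom.range_eq_top.2 hκ, MonoidHom.comp_id,
        ← MonoidHom.range_eq_map, Monoid.Coprod.range_inl_sup_range_inr]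
    have hc : (Monoid.Coprod.lift (sSup 𝒮).subtype B.subtype).comp
        (Monoid.Coprod.map κ (MonoidHom.id B)) =
        Monoid.Coprod.lift (Monoid.CoprodI.lift fun P : 𝒮 => (P : Subgroup F).subtype)
          B.subtype := by
      refine Monoid.Coprod.hom_ext ?_ ?_
      · ext p
        simp [κ]
      · ext p
        simp
    intro x y hxy
    obtain ⟨x, rfl⟩ := hs x
    obtain ⟨y, rfl⟩ := hs y
    congr 1
    apply h.1
    rw [← hc]
    exact hxy
  · rw [← MonoidHom.range_eq_top, Monoid.Coprod.range_lift, Subgroup.range_subtype,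
      Subgroup.range_subtype, h.sup_eq_top]

theorem FreeDecomp.injective_lift (h : FreeDecomp 𝒮 B) :
    Function.Injective (Monoid.CoprodI.lift fun P : 𝒮 => (P : Subgroup F).subtype) := by
  intro x y hxy
  apply Monoid.Coprod.inl_injective (N := B)
  apply h.1
  simpa using hxy

theorem IsNontrivialFreeFactorSystem.exists_freeDecomp {𝒜 : Set (Subgroup F)}
    (h : IsNontrivialFreeFactorSystem 𝒜) : ∃ B, FreeDecomp 𝒜 B := by
  obtain ⟨B, hB⟩ := h.freeFactor
  refine ⟨B, ?_⟩
  let e : Monoid.CoprodI (fun P : 𝒜 => (P : Subgroup F)) ≃*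
      (sSup 𝒜 : Subgroup F) :=
    (MonoidHom.ofInjective h.freeProduct).trans
      (MulEquiv.subgroupCongr (range_lift_subtype 𝒜))
  have hc : (Monoid.Coprod.lift (sSup 𝒜).subtype B.subtype).comp
        (MulEquiv.coprodCongr e (MulEquiv.refl B)).toMonoidHom =
        Monoid.Coprod.lift (Monoid.CoprodI.lift fun P : 𝒜 => (P : Subgroup F).subtype)
          B.subtype := by
    refine Monoid.Coprod.hom_ext ?_ ?_
    · ext p
      simp [e, MonoidHom.ofInjective_apply]
    · ext p
      simp
  rw [FreeDecomp, ← hc]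
  exact hB.comp (MulEquiv.coprodCongr e (MulEquiv.refl B)).bijective

/-- The omitted components are absorbed into the complement; the left inverse is defined factor by
factor. -/
theorem FreeDecomp.subset (h : FreeDecomp 𝒮 B) {𝒬 : Set (Subgroup F)} (hs : 𝒬 ⊆ 𝒮) :
    FreeDecomp 𝒬 (sSup (𝒮 \ 𝒬) ⊔ B) := by
  classical
  set B' := sSup (𝒮 \ 𝒬) ⊔ B with hB'
  have hB : B ≤ B' := le_sup_right
  have hP : ∀ P ∈ 𝒮, P ∉ 𝒬 → P ≤ B' := fun P hP hQ =>
    (le_sSup (show P ∈ 𝒮 \ 𝒬 from ⟨hP, hQ⟩)).trans le_sup_left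
  obtain ⟨f, hf, hfB⟩ := h.exists_hom
    (K := Monoid.Coprod (Monoid.CoprodI fun P : 𝒬 => (P : Subgroup F)) B')
    (fun P => if hQ : (P : Subgroup F) ∈ 𝒬 then
        Monoid.Coprod.inl.comp
          (Monoid.CoprodI.of (M := fun P : 𝒬 => (P : Subgroup F)) (i := ⟨P, hQ⟩))
      else Monoid.Coprod.inr.comp (Subgroup.inclusion (hP P P.2 hQ)))
    (Monoid.Coprod.inr.comp (Subgroup.inclusion hB))
  refine freeDecomp_of_hom ?_ f ?_ ?_
  · rw [hB', ← sup_assoc, ← sSup_union, Set.union_sdiff_cancel hs, h.sup_eq_top]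
  · intro P p
    have := hf ⟨P, hs P.2⟩ p
    simpa [P.2] using this
  · refine hom_eq_of_le_map_eqLocus ?_
    conv_lhs => rw [hB']
    refine sup_le (sSup_le ?_) ?_
    · rintro P ⟨hP1, hP2⟩ p hp
      refine ⟨⟨p, hP P hP1 hP2 hp⟩, ?_, rfl⟩
      have := hf ⟨P, hP1⟩ ⟨p, hp⟩
      simp only [hP2, dite_false] at this
      exact this
    · intro p hp
      exact ⟨⟨p, hB hp⟩, hfB ⟨p, hp⟩, rfl⟩

/-- A homomorphism on one component extends to `F`, killing the other components. -/
theorem FreeDecomp.exists_extension (h : FreeDecomp 𝒮 B) {P : Subgroup F} (hP : P ∈ 𝒮)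
    {K : Type*} [Group K] (χ : P →* K) :
    ∃ f : F →* K, (∀ p : P, f p = χ p) ∧ ∀ Q ∈ 𝒮, Q ≠ P → ∀ q ∈ Q, f q = 1 := by
  classical
  obtain ⟨f, hf, -⟩ := h.exists_hom (K := K)
    (fun Q => if hQ : (Q : Subgroup F) = P then
      χ.comp (Subgroup.inclusion hQ.le) else 1) 1
  refine ⟨f, fun p => ?_, fun Q hQ hne q hq => ?_⟩
  · have := hf ⟨P, hP⟩ p
    simp only [dite_true] at this
    exact this
  · simpa [hne] using hf ⟨Q, hQ⟩ ⟨q, hq⟩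

/-- Let `f` be the retraction onto `P` killing the other components. If `Q ≠ P`, then `f` kills the
conjugate of `Q`, hence `P`. If `Q = P`, then `f` is injective on `xPx⁻¹`, and `y * (f y)⁻¹` lies in
its kernel there, so `y = f y ∈ P`. -/
theorem FreeDecomp.eq_of_le_conjBy (h : FreeDecomp 𝒮 B) {P Q : Subgroup F} (hP : P ∈ 𝒮)
    (hQ : Q ∈ 𝒮) (hne : P ≠ ⊥) {x : F} (hle : P ≤ conjBy x Q) : P = Q ∧ conjBy x Q = P := by
  obtain ⟨f, hf, hf'⟩ := h.exists_extension hP (MonoidHom.id P)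
  have hPQ : P = Q := by
    by_contra hPQ
    apply hne
    rw [Subgroup.eq_bot_iff_forall]
    intro p hp
    have h1 := hf' Q hQ (Ne.symm hPQ) _ (mem_conjBy.1 (hle hp))
    have h2 := hf ⟨p, hp⟩
    simp only [MonoidHom.id_apply] at h2
    rw [map_mul, map_mul, h2, map_inv, mul_eq_one_iff_eq_inv, inv_mul_eq_iff_eq_mul,
      mul_inv_cancel] at h1
    exact congrArg Subtype.val h1
  subst hPQ
  refine ⟨rfl, le_antisymm ?_ hle⟩
  have hinj : ∀ y ∈ conjBy x P, f y = 1 → y = 1 := by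
    intro y hy hy1
    have h2 := hf ⟨_, mem_conjBy.1 hy⟩
    rw [map_mul, map_mul, hy1, mul_one, map_inv, inv_mul_cancel] at h2
    have h3 : x⁻¹ * y * x = 1 := congrArg Subtype.val h2.symm
    rwa [mul_eq_one_iff_eq_inv, inv_mul_eq_iff_eq_mul, mul_inv_cancel] at h3
  intro y hy
  have h1 : y * (f y : F)⁻¹ = 1 := by
    refine hinj _ (mul_mem hy (inv_mem (hle (f y).2))) ?_
    rw [map_mul, map_inv, hf (f y)]
    simp
  rw [mul_inv_eq_one.1 h1]
  exact (f y).2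

end FreeDecomp

/-! ### The Kurosh subgroup theorem through cocycles on cosets. -/

section Kurosh

/-- Compatible choices of coset and double coset representatives for the action of a group `F`,
generated by subgroups `S i`, on a set `X` with base point `x₀`. For each `i`, `r i` picks a base
point in every `S i`-orbit and `a i x ∈ S i` moves the base point of the orbit of `x` to `x`;
`t x` moves `x₀` to `x`, and is built up along orbits of decreasing depth. -/
structure TransversalSystem {F : Type*} [Group F] {ι : Type*} (S : ι → Subgroup F)
    (X : Type*) [MulAction F X] (x₀ : X) where
  t : X → F
  r : ι → X → X
  a : ι → X → F
  depth : X → ℕ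
  a_mem : ∀ i x, a i x ∈ S i
  a_smul : ∀ i x, a i x • r i x = x
  a_root : ∀ i x, a i (r i x) = 1
  r_smul : ∀ i x, ∀ s ∈ S i, r i (s • x) = r i x
  t_base : t x₀ = 1
  t_step : ∀ x, x ≠ x₀ → ∃ i, depth (r i x) < depth x ∧ t x = a i x * t (r i x)

/-- The depth of `x` is the least number of factors from the `S i` needed to reach it from `x₀`. -/
theorem exists_depth {F : Type*} [Group F] {ι : Type*} (S : ι → Subgroup F)
    (hgen : ⨆ i, S i = ⊤) (X : Type*) [MulAction F X] [MulAction.IsPretransitive F X] (x₀ : X) :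
    ∃ d : X → ℕ, ∀ x, x ≠ x₀ → ∃ i, ∃ s ∈ S i, d (s • x) < d x := by
  classical
  let R : ℕ → Set X := fun n =>
    Nat.rec (motive := fun _ => Set X) {x₀} (fun _ T => {x | ∃ i, ∃ s ∈ S i, s • x ∈ T}) n
  have hR : ∀ x, ∃ n, x ∈ R n := by
    have key : ∀ g : F, ∀ x, (∃ n, x ∈ R n) → ∃ n, g • x ∈ R n := by
      intro g
      have hg : g ∈ ⨆ i, S i := by rw [hgen]; trivial
      induction hg using Subgroup.iSup_induction' with
      | hp i s hs =>
        rintro x ⟨n, hn⟩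
        exact ⟨n + 1, i, s⁻¹, inv_mem hs, by simpa using hn⟩
      | h1 => simp
      | hmul g h _ _ hg hh =>
        intro x hx
        rw [mul_smul]
        exact hg _ (hh _ hx)
    intro x
    obtain ⟨g, rfl⟩ := MulAction.exists_smul_eq F x₀ x
    exact key g x₀ ⟨0, rfl⟩
  refine ⟨fun x => Nat.find (hR x), fun x hx => ?_⟩
  change ∃ i, ∃ s ∈ S i, Nat.find (hR (s • x)) < Nat.find (hR x)
  have h := Nat.find_spec (hR x)
  cases hn : Nat.find (hR x) with
  | zero =>
    rw [hn] at h
    exact absurd h hx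
  | succ n =>
    rw [hn] at h
    obtain ⟨i, s, hs, hm⟩ := h
    exact ⟨i, s, hs, Nat.lt_succ_of_le (Nat.find_min' (hR (s • x)) hm)⟩

theorem nonempty_transversalSystem {F : Type*} [Group F] {ι : Type*} (S : ι → Subgroup F)
    (hgen : ⨆ i, S i = ⊤) (X : Type*) [MulAction F X] [MulAction.IsPretransitive F X] (x₀ : X) :
    Nonempty (TransversalSystem S X x₀) := by
  classical
  obtain ⟨d, hd⟩ := exists_depth S hgen X x₀
  -- Rooting each orbit at a point of least depth makes the recursion for `t` well founded.
  let r : ι → X → X := fun i x =>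
    d.argminOn (MulAction.orbit (S i) x) ⟨x, MulAction.mem_orbit_self x⟩
  have hr : ∀ i x, r i x ∈ MulAction.orbit (S i) x := fun i x => d.argminOn_mem _ _
  have hle : ∀ i x, ∀ y ∈ MulAction.orbit (S i) x, d (r i x) ≤ d y :=
    fun i x y hy => d.argminOn_le _ hy
  have r_smul : ∀ i x, ∀ s ∈ S i, r i (s • x) = r i x := by
    intro i x s hs
    have : MulAction.orbit (S i) (s • x) = MulAction.orbit (S i) x :=
      MulAction.orbit_eq_iff.2 ⟨⟨s, hs⟩, rfl⟩
    simp only [r, this]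
  have r_r : ∀ i x, r i (r i x) = r i x := by
    intro i x
    obtain ⟨s, hs⟩ := hr i x
    have := r_smul i x s s.2
    rwa [show (s : F) • x = r i x from hs] at this
  have ha : ∀ i x, ∃ a ∈ S i, a • r i x = x ∧ (r i x = x → a = 1) := by
    intro i x
    by_cases h : r i x = x
    · exact ⟨1, one_mem _, by simpa using h, fun _ => rfl⟩
    · obtain ⟨s, hs⟩ := hr i x
      refine ⟨(s : F)⁻¹, inv_mem s.2, ?_, fun h' => absurd h' h⟩
      rw [inv_smul_eq_iff]
      exact hs.symm
  choose a a_mem a_smul a_one using ha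
  have hl : ∀ x, x ≠ x₀ → ∃ i, d (r i x) < d x := by
    intro x hx
    obtain ⟨i, s, hs, hlt⟩ := hd x hx
    exact ⟨i, (hle i x _ ⟨⟨s, hs⟩, rfl⟩).trans_lt hlt⟩
  choose l hl using hl
  let t : X → F := (measure d).wf.fix fun x ih =>
    if h : x = x₀ then 1 else a (l x h) x * ih (r (l x h) x) (hl x h)
  have ht : ∀ x, t x = if h : x = x₀ then 1 else a (l x h) x * t (r (l x h) x) := fun x =>
    (measure d).wf.fix_eq _ x
  refine ⟨⟨t, r, a, d, a_mem, a_smul, fun i x => a_one i _ (r_r i x), r_smul, ?_, ?_⟩⟩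
  · rw [ht]; simp
  · intro x hx
    refine ⟨l x hx, hl x hx, ?_⟩
    rw [ht, dif_neg hx]

namespace TransversalSystem

variable {F L : Type u} [Group F] [Group L] {ι : Type u} {S : ι → Subgroup F} {ψ : L →* F}
  (T : TransversalSystem S (F ⧸ ψ.range) ((1 : F) : F ⧸ ψ.range))

theorem r_r (i : ι) (x : F ⧸ ψ.range) : T.r i (T.r i x) = T.r i x := by
  conv_rhs => rw [← T.a_smul i x]
  rw [T.r_smul i _ _ (T.a_mem i x)]

theorem t_smul (x : F ⧸ ψ.range) : T.t x • ((1 : F) : F ⧸ ψ.range) = x := by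
  induction hn : T.depth x using Nat.strong_induction_on generalizing x with
  | _ n ih =>
    by_cases hx : x = ((1 : F) : F ⧸ ψ.range)
    · rw [hx, T.t_base, one_smul]
    · obtain ⟨i, hi, ht⟩ := T.t_step x hx
      rw [ht, mul_smul, ih _ (hn ▸ hi) _ rfl, T.a_smul]

theorem apply_invFun {g : F} (hg : g • ((1 : F) : F ⧸ ψ.range) = ((1 : F) : F ⧸ ψ.range)) :
    ψ (Function.invFun ψ g) = g := by
  apply Function.invFun_eq
  rw [← MulAction.mem_stabilizer_iff, MulAction.stabilizer_quotient] at hg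
  exact hg

/-- The stabilizers, pulled back to `L`, that are the nonfree factors of `L`. -/
def vertex (i : ι) (x : F ⧸ ψ.range) : Subgroup L :=
  (conjBy (T.t (T.r i x))⁻¹ (S i)).comap ψ

/-- The elements of `L` that generate the free part. -/
noncomputable def edge (i : ι) (x : F ⧸ ψ.range) : L :=
  Function.invFun ψ ((T.t x)⁻¹ * T.a i x * T.t (T.r i x))

/-- The part of `s ∈ S i` that lies in a vertex group, relative to the transversals. -/
noncomputable def localPart (i : ι) (s : F) (x : F ⧸ ψ.range) : L :=
  Function.invFun ψ ((T.t (T.r i x))⁻¹ * (T.a i (s • x))⁻¹ * s * T.a i x * T.t (T.r i x))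

theorem apply_edge (i : ι) (x : F ⧸ ψ.range) :
    ψ (T.edge i x) = (T.t x)⁻¹ * T.a i x * T.t (T.r i x) := by
  apply apply_invFun
  rw [mul_smul, mul_smul, T.t_smul, T.a_smul, inv_smul_eq_iff, T.t_smul]

theorem apply_local {i : ι} {s : F} (hs : s ∈ S i) (x : F ⧸ ψ.range) :
    ψ (T.localPart i s x) =
      (T.t (T.r i x))⁻¹ * (T.a i (s • x))⁻¹ * s * T.a i x * T.t (T.r i x) := by
  apply apply_invFun
  simp only [mul_smul]
  rw [T.t_smul, T.a_smul, inv_smul_eq_iff, inv_smul_eq_iff, T.t_smul]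
  conv_rhs => rw [← T.r_smul i x s hs, T.a_smul]

theorem local_mem {i : ι} {s : F} (hs : s ∈ S i) (x : F ⧸ ψ.range) :
    T.localPart i s x ∈ T.vertex i x := by
  rw [vertex, Subgroup.mem_comap, T.apply_local hs, mem_conjBy]
  have := mul_mem (mul_mem (inv_mem (T.a_mem i (s • x))) hs) (T.a_mem i x)
  simpa [mul_assoc] using this

theorem vertex_smul {i : ι} {s : F} (hs : s ∈ S i) (x : F ⧸ ψ.range) :
    T.vertex i (s • x) = T.vertex i x := by
  rw [vertex, T.r_smul i x s hs, vertex]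

theorem vertex_r (i : ι) (x : F ⧸ ψ.range) : T.vertex i (T.r i x) = T.vertex i x := by
  rw [vertex, T.r_r, vertex]

theorem local_mul (hψ : Function.Injective ψ) {i : ι} {s s' : F} (hs : s ∈ S i) (hs' : s' ∈ S i)
    (x : F ⧸ ψ.range) :
    T.localPart i (s * s') x = T.localPart i s (s' • x) * T.localPart i s' x := by
  apply hψ
  rw [map_mul, T.apply_local (mul_mem hs hs'), T.apply_local hs, T.apply_local hs',
    T.r_smul i x s' hs', mul_smul]
  group

theorem local_one (hψ : Function.Injective ψ) (i : ι) (x : F ⧸ ψ.range) :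
    T.localPart i 1 x = 1 := by
  apply hψ
  rw [T.apply_local (one_mem _), one_smul, map_one]
  group

/-- Reidemeister–Schreier rewriting: `t(gx)⁻¹ g t(x)` splits into edge and vertex elements, one
syllable of `g` at a time. For `g = ψ l` at the base coset it is `ψ l` itself. -/
theorem eq_top_of_le (hψ : Function.Injective ψ) (hgen : ⨆ i, S i = ⊤) (K : Subgroup L)
    (hv : ∀ i x, T.vertex i x ≤ K) (he : ∀ i x, T.edge i x ∈ K) : K = ⊤ := by
  have key : ∀ g : F, ∀ x, (T.t (g • x))⁻¹ * g * T.t x ∈ K.map ψ := by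
    intro g
    have hg : g ∈ ⨆ i, S i := by rw [hgen]; trivial
    induction hg using Subgroup.iSup_induction' with
    | hp i s hs =>
      intro x
      refine ⟨T.edge i (s • x) * T.localPart i s x * (T.edge i x)⁻¹,
        mul_mem (mul_mem (he _ _) (hv i x (T.local_mem hs x))) (inv_mem (he _ _)), ?_⟩
      rw [map_mul, map_mul, map_inv, T.apply_edge, T.apply_edge, T.apply_local hs,
        T.r_smul i x s hs]
      group
    | h1 => simp [one_mem]
    | hmul g h _ _ hg hh =>
      intro x
      have := mul_mem (hg (h • x)) (hh x)
      rw [← mul_smul] at this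
      simpa [mul_assoc] using this
  rw [eq_top_iff]
  intro l _
  have hl : ψ l • ((1 : F) : F ⧸ ψ.range) = ((1 : F) : F ⧸ ψ.range) := by
    rw [← MulAction.mem_stabilizer_iff, MulAction.stabilizer_quotient]
    exact ⟨l, rfl⟩
  have := key (ψ l) ((1 : F) : F ⧸ ψ.range)
  rw [hl, T.t_base, inv_one, one_mul, mul_one] at this
  obtain ⟨k, hk, hkl⟩ := this
  rwa [← hψ hkl]

/-- The universal property of `L` is deduced from that of `F` by an induced action: the data define
a `G`-valued cocycle on each `S i`, these glue to a cocycle of `F` on the cosets, and its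
restriction to the stabilizer `ψ(L)` of the base coset is a homomorphism. -/
theorem exists_hom (hψ : Function.Injective ψ) (hgen : ⨆ i, S i = ⊤)
    (hext : ∀ (K : Type u) [Group K] (g : ∀ i, S i →* K),
      ∃ f : F →* K, ∀ i (s : S i), f s = g i s)
    {G : Type u} [Group G] (e : ι → ∀ Q : Subgroup L, Q →* G) (γ : ι → F ⧸ ψ.range → G)
    (hγ : ∀ i x, T.edge i x = 1 → γ i x = 1) :
    ∃ f : L →* G, (∀ i x (l : T.vertex i x), f l = e i (T.vertex i x) l) ∧
      ∀ i x, f (T.edge i x) = γ i x := by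
  have he : ∀ i (Q Q' : Subgroup L), Q = Q' → ∀ l (h : l ∈ Q) (h' : l ∈ Q'),
      e i Q ⟨l, h⟩ = e i Q' ⟨l, h'⟩ := by
    rintro i Q _ rfl l h h'
    rfl
  let x₀ : F ⧸ ψ.range := ((1 : F) : F ⧸ ψ.range)
  -- the cocycle on each factor
  let C : ∀ i, S i → F ⧸ ψ.range → G := fun i s x =>
    γ i ((s : F) • x) * e i (T.vertex i x) ⟨T.localPart i s x, T.local_mem s.2 x⟩ * (γ i x)⁻¹
  have hC1 : ∀ i x, C i 1 x = 1 := by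
    intro i x
    have : (⟨T.localPart i ((1 : S i) : F) x, T.local_mem (1 : S i).2 x⟩ : T.vertex i x) = 1 :=
      Subtype.ext (T.local_one hψ i x)
    simp only [C, this]
    simp
  have hCmul : ∀ i (s s' : S i) x, C i (s * s') x = C i s ((s' : F) • x) * C i s' x := by
    intro i s s' x
    have h1 : (⟨T.localPart i ((s * s' : S i) : F) x, T.local_mem (s * s').2 x⟩ : T.vertex i x) =
        ⟨T.localPart i s ((s' : F) • x), by
          rw [← T.vertex_smul s'.2]; exact T.local_mem s.2 _⟩ *
        ⟨T.localPart i s' x, T.local_mem s'.2 x⟩ :=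
      Subtype.ext (T.local_mul hψ s.2 s'.2 x)
    simp only [C, h1, map_mul]
    rw [he i _ _ (T.vertex_smul s'.2 x) (T.localPart i s ((s' : F) • x))
      (T.local_mem s.2 _) (by rw [← T.vertex_smul s'.2]; exact T.local_mem s.2 _)]
    simp [mul_smul, mul_assoc]
  -- The cocycle identity makes the skew product an action, so the universal property of `F` can be
  -- applied to a permutation group.
  let ρ : ∀ i, S i →* Equiv.Perm ((F ⧸ ψ.range) × G) := fun i => MonoidHom.toHomPerm
    { toFun := fun s p => ((s : F) • p.1, C i s p.1 * p.2)
      map_one' := by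
        funext p
        simp only [OneMemClass.coe_one, one_smul, hC1, one_mul]
        rfl
      map_mul' := by
        intro s s'
        funext p
        simp only [Subgroup.coe_mul, hCmul, mul_smul, mul_assoc]
        rfl }
  obtain ⟨Ψ, hΨ⟩ := hext _ ρ
  have hΨ' : ∀ i (s : S i) x g, Ψ s (x, g) = ((s : F) • x, C i s x * g) := by
    intro i s x g
    rw [hΨ]
    rfl
  -- the cocycle on `F`
  have hcov : ∀ g : F, ∀ x u, Ψ g (x, u) = (g • x, (Ψ g (x, 1)).2 * u) := by
    intro g
    have hg : g ∈ ⨆ i, S i := by rw [hgen]; trivial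
    induction hg using Subgroup.iSup_induction' with
    | hp i s hs =>
      intro x u
      rw [hΨ' i ⟨s, hs⟩, hΨ' i ⟨s, hs⟩]
      simp
    | h1 => simp
    | hmul g h _ _ hg hh =>
      intro x u
      rw [map_mul, Equiv.Perm.mul_apply, Equiv.Perm.mul_apply, hh, hg, hh x 1,
        hg _ (_ * 1)]
      simp [mul_smul, mul_assoc]
  let c : F → F ⧸ ψ.range → G := fun g x => (Ψ g (x, 1)).2
  have c_mul : ∀ g h x, c (g * h) x = c g (h • x) * c h x := by
    intro g h x
    simp only [c]
    rw [map_mul, Equiv.Perm.mul_apply, hcov h, hcov g]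
  have c_one : ∀ x, c 1 x = 1 := fun x => by simp [c]
  have c_S : ∀ i (s : S i) x, c s x = C i s x := by
    intro i s x
    simp only [c, hΨ', mul_one]
  have c_inv : ∀ g x, c g⁻¹ (g • x) = (c g x)⁻¹ := by
    intro g x
    rw [eq_inv_iff_mul_eq_one, ← c_mul, inv_mul_cancel, c_one]
  have γ_root : ∀ i x, γ i (T.r i x) = 1 := by
    intro i x
    apply hγ
    apply hψ
    rw [T.apply_edge, T.a_root, T.r_r, map_one, mul_one, inv_mul_cancel]
  have c_a : ∀ i x, c (T.a i x) (T.r i x) = γ i x := by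
    intro i x
    rw [c_S i ⟨_, T.a_mem i x⟩]
    have h1 : (⟨T.localPart i (T.a i x) (T.r i x), T.local_mem (T.a_mem i x) (T.r i x)⟩ :
        T.vertex i (T.r i x)) = 1 := by
      apply Subtype.ext
      apply hψ
      rw [T.apply_local (T.a_mem i x), T.a_smul, T.a_root]
      simp
    simp only [C, T.a_smul, h1, γ_root]
    simp
  -- Each step in the construction of `t` has trivial edge element, hence trivial `γ`.
  have c_t : ∀ x, c (T.t x) x₀ = 1 := by
    intro x
    induction hn : T.depth x using Nat.strong_induction_on generalizing x with
    | _ n ih =>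
      by_cases hx : x = x₀
      · rw [hx, T.t_base, c_one]
      · obtain ⟨i, hi, ht⟩ := T.t_step x hx
        rw [ht, c_mul, ih _ (hn ▸ hi) _ rfl, T.t_smul, c_a, mul_one]
        apply hγ
        apply hψ
        rw [T.apply_edge, ht, map_one]
        group
  have c_t_inv : ∀ x, c (T.t x)⁻¹ x = 1 := by
    intro x
    have := c_inv (T.t x) x₀
    rwa [T.t_smul, c_t, inv_one] at this
  have hstab : ∀ l : L, ψ l • x₀ = x₀ := by
    intro l
    rw [← MulAction.mem_stabilizer_iff, MulAction.stabilizer_quotient]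
    exact ⟨l, rfl⟩
  let f : L →* G := MonoidHom.mk' (fun l => c (ψ l) x₀) fun l l' => by
    rw [map_mul, c_mul, hstab]
  refine ⟨f, ?_, ?_⟩
  · rintro i x ⟨l, hl⟩
    change c (ψ l) x₀ = _
    have hl' := hl
    rw [vertex, Subgroup.mem_comap, mem_conjBy, inv_inv] at hl'
    set y := T.r i x with hy
    set s := T.t y * ψ l * (T.t y)⁻¹ with hs
    have hsy : s • y = y := by
      conv_lhs => rw [← T.t_smul y]
      rw [hs, ← mul_smul, inv_mul_cancel_right, mul_smul]
      exact (congrArg _ (hstab l)).trans (T.t_smul y)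
    have hsl : ψ l = (T.t y)⁻¹ * (s * T.t y) := by simp [hs, mul_assoc]
    have h1 : T.localPart i s y = l := by
      apply hψ
      rw [T.apply_local hl', hsy, hsl, hy, T.a_root, T.r_r]
      group
    rw [hsl, c_mul, c_mul, c_t, mul_smul, T.t_smul, hsy, c_t_inv, c_S i ⟨s, hl'⟩]
    simp only [C]
    rw [hsy, hy, γ_root, inv_one]
    rw [he i _ _ (T.vertex_r i x) _ _ (by rw [← hy, h1]; exact hl)]
    simp only [one_mul, mul_one]
    exact congrArg (e i (T.vertex i x)) (Subtype.ext h1)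
  · intro i x
    change c (ψ (T.edge i x)) x₀ = _
    rw [T.apply_edge, mul_assoc, c_mul, c_mul, c_t, mul_smul, T.t_smul, T.a_smul, c_t_inv, c_a,
      one_mul, mul_one]

end TransversalSystem

end Kurosh

/-! ### Pulling back free decompositions along injections. -/

section Pullback

variable {F L : Type u} [Group F] [Group L]

/-- The preimages of the conjugates of the components of a free factor system form, up to
conjugacy, the components of a free decomposition. -/
theorem FreeDecomp.exists_pullback {𝒜 : Set (Subgroup F)} {C : Subgroup F} (h : FreeDecomp 𝒜 C)
    {ψ : L →* F} (hψ : Function.Injective ψ) :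
    ∃ (𝒮 : Set (Subgroup L)) (B : Subgroup L), FreeDecomp 𝒮 B ∧
      (∀ P ∈ 𝒮, P ≠ ⊥ ∧ ∃ A ∈ 𝒜, ∃ x, P = (conjBy x A).comap ψ) ∧
      ∀ A ∈ 𝒜, ∀ x, (conjBy x A).comap ψ ≠ ⊥ →
        ∃ P ∈ 𝒮, ∃ l, (conjBy x A).comap ψ = conjBy l P := by
  classical
  let S : Option 𝒜 → Subgroup F := fun o => o.elim C fun A => A
  have hgen : ⨆ i, S i = ⊤ := by
    rw [iSup_option, sup_comm, ← h.sup_eq_top, sSup_eq_iSup']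
    rfl
  have hext : ∀ (K : Type u) [Group K] (g : ∀ i, S i →* K),
      ∃ f : F →* K, ∀ i (s : S i), f s = g i s := by
    intro K _ g
    obtain ⟨f, hf, hf'⟩ := h.exists_hom (fun A => g (some A)) (g none)
    refine ⟨f, fun i => ?_⟩
    cases i with
    | none => exact hf'
    | some A => exact hf A
  obtain ⟨T⟩ := nonempty_transversalSystem S hgen (F ⧸ ψ.range) ((1 : F) : F ⧸ ψ.range)
  set 𝒮 : Set (Subgroup L) := {P | P ≠ ⊥ ∧ ∃ A x, P = T.vertex (some A) x} with h𝒮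
  set B : Subgroup L := (⨆ x, T.vertex none x) ⊔
    Subgroup.closure (Set.range fun p : Option 𝒜 × (F ⧸ ψ.range) => T.edge p.1 p.2) with hB
  have hvB : ∀ x, T.vertex none x ≤ B := fun x => (le_iSup _ x).trans le_sup_left
  have heB : ∀ i x, T.edge i x ∈ B := fun i x =>
    (le_sup_right : _ ≤ B) (Subgroup.subset_closure ⟨(i, x), rfl⟩)
  refine ⟨𝒮, B, ?_, ?_, ?_⟩
  -- The map depends on the subgroup and on whether the index is `none`, not on the coset, so equal
  -- vertex groups need not be told apart. For an index `some A` the default `1` is met only by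
  -- trivial vertex groups.
  · let e : Option 𝒜 → ∀ Q : Subgroup L,
        Q →* Monoid.Coprod (Monoid.CoprodI fun P : 𝒮 => (P : Subgroup L)) B := fun i Q =>
      if i = none then
        if hQ : Q ≤ B then Monoid.Coprod.inr.comp (Subgroup.inclusion hQ) else 1
      else if hQ : Q ∈ 𝒮 then
        Monoid.Coprod.inl.comp
          (Monoid.CoprodI.of (M := fun P : 𝒮 => (P : Subgroup L)) (i := ⟨Q, hQ⟩))
      else 1
    obtain ⟨f, hf, hf'⟩ := T.exists_hom hψ hgen hext e
      (fun i x => Monoid.Coprod.inr ⟨T.edge i x, heB i x⟩) (by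
        intro i x hx
        rw [← map_one Monoid.Coprod.inr]
        exact congrArg _ (Subtype.ext hx))
    refine freeDecomp_of_hom ?_ f ?_ ?_
    · refine T.eq_top_of_le hψ hgen _ ?_ ?_
      · rintro (_ | A) x
        · exact (hvB x).trans le_sup_right
        · by_cases hb : T.vertex (some A) x = ⊥
          · rw [hb]; exact bot_le
          · exact (le_sSup (show _ ∈ 𝒮 from ⟨hb, A, x, rfl⟩)).trans le_sup_left
      · exact fun i x => (le_sup_right : B ≤ _) (heB i x)
    · rintro ⟨P, hP⟩ p
      obtain ⟨-, A, x, rfl⟩ := id hP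
      have := hf (some A) x p
      simp only [e, reduceCtorEq, if_false, hP, dite_true] at this
      exact this
    · refine hom_eq_of_le_map_eqLocus ?_
      conv_lhs => rw [hB]
      refine sup_le (iSup_le fun x p hp => ?_) ((Subgroup.closure_le _).2 ?_)
      · refine ⟨⟨p, hvB x hp⟩, ?_, rfl⟩
        have := hf none x ⟨p, hp⟩
        simp only [e, if_true, hvB x, dite_true] at this
        exact this
      · rintro _ ⟨⟨i, x⟩, rfl⟩
        exact ⟨⟨_, heB i x⟩, hf' i x, rfl⟩
  · rintro P ⟨hP, A, x, rfl⟩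
    exact ⟨hP, A, A.2, _, rfl⟩
  · intro A hA x hne
    -- The `A`-orbit of this coset is the double coset of `x⁻¹`; moving `x` to its representative
    -- costs a factor in `A`, which normalizes `A`, and one in `ψ(L)`.
    let y : F ⧸ ψ.range := x⁻¹ • ((1 : F) : F ⧸ ψ.range)
    let i : Option 𝒜 := some ⟨A, hA⟩
    have ha : T.a i y ∈ A := T.a_mem i y
    have hl : ψ (Function.invFun ψ (x * T.a i y * T.t (T.r i y))) =
        x * T.a i y * T.t (T.r i y) := by
      apply TransversalSystem.apply_invFun
      rw [mul_smul, mul_smul, T.t_smul, T.a_smul, smul_inv_smul]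
    have key : (conjBy x A).comap ψ =
        conjBy (Function.invFun ψ (x * T.a i y * T.t (T.r i y))) (T.vertex i y) := by
      rw [TransversalSystem.vertex, conjBy_comap, hl, conjBy_conjBy, mul_inv_cancel_right,
        ← conjBy_conjBy]
      congr 2
      exact (conjBy_of_mem ha).symm
    refine ⟨T.vertex i y, ⟨?_, _, _, rfl⟩, _, key⟩
    intro hb
    rw [hb, conjBy_bot] at key
    exact hne key

end Pullback

/-! ### Finiteness from homomorphisms to `ℤ/2`. -/

section FiniteRank

/-- A nontrivial free group maps onto `ℤ/2`. -/
theorem exists_hom_ne_one (G : Type*) [Group G] [IsFreeGroup G] [Nontrivial G] :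
    ∃ (χ : G →* Multiplicative (ZMod 2)) (g : G), χ g ≠ 1 := by
  rcases isEmpty_or_nonempty (IsFreeGroup.Generators G) with h | ⟨⟨a⟩⟩
  · exfalso
    have : MonoidHom.id G = 1 := IsFreeGroup.ext_hom fun a => h.elim a
    obtain ⟨g, hg⟩ := exists_ne (1 : G)
    exact hg (DFunLike.congr_fun this g)
  · refine ⟨IsFreeGroup.lift fun _ => Multiplicative.ofAdd 1, IsFreeGroup.of a, ?_⟩
    rw [IsFreeGroup.lift_of]
    decide

variable {F : Type u} [Group F]

/-- By Nielsen–Schreier, `P` is itself free. -/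
theorem exists_hom_ne_one_of_ne_bot [IsFreeGroup F] {P : Subgroup F} (hP : P ≠ ⊥) :
    ∃ (χ : P →* Multiplicative (ZMod 2)) (p : P), χ p ≠ 1 :=
  have := (Subgroup.nontrivial_iff_ne_bot P).2 hP
  exists_hom_ne_one P

theorem finite_hom {n : ℕ} (b : FreeGroupBasis (Fin n) F) :
    Finite (F →* Multiplicative (ZMod 2)) :=
  Finite.of_equiv _ b.lift

/-- Each component is detected by a homomorphism to `ℤ/2` that kills all the others, so components
inject into a finite set. -/
theorem FreeDecomp.finite [IsFreeGroup F] [Finite (F →* Multiplicative (ZMod 2))]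
    {𝒮 : Set (Subgroup F)} {B : Subgroup F} (h : FreeDecomp 𝒮 B) (hne : ∀ P ∈ 𝒮, P ≠ ⊥) :
    𝒮.Finite := by
  have H : ∀ P : 𝒮, ∃ f : F →* Multiplicative (ZMod 2), (∃ p ∈ (P : Subgroup F), f p ≠ 1) ∧
      ∀ Q ∈ 𝒮, Q ≠ P → ∀ q ∈ Q, f q = 1 := by
    intro P
    obtain ⟨χ, p, hp⟩ := exists_hom_ne_one_of_ne_bot (hne P P.2)
    obtain ⟨f, hf, hf'⟩ := h.exists_extension P.2 χ
    exact ⟨f, ⟨p, p.2, by rwa [hf]⟩, hf'⟩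
  choose f hf hf' using H
  have hinj : Function.Injective f := by
    intro P Q hPQ
    by_contra hne'
    obtain ⟨p, hp, hp1⟩ := hf P
    exact hp1 (hPQ ▸ hf' Q P P.2 (fun h => hne' (Subtype.ext h)) p hp)
  exact Set.finite_coe_iff.1 (Finite.of_injective f hinj)

end FiniteRank

/-! ### Stabilization of ascending chains. -/

section Chain

variable {F : Type u} [Group F]

/-- The homomorphism `χ` is trivial on all components of `𝒮`. -/
def Kills {K : Type*} [Group K] (χ : F →* K) (𝒮 : Set (Subgroup F)) : Prop :=
  ∀ P ∈ 𝒮, ∀ p ∈ P, χ p = 1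

theorem Kills.of_carries {K : Type*} [CommGroup K] {χ : F →* K} {𝒮 𝒯 : Set (Subgroup F)}
    (h : Kills χ 𝒯) (hc : Carries 𝒯 𝒮) : Kills χ 𝒮 := by
  intro P hP p hp
  obtain ⟨Q, hQ, x, hx⟩ := hc P hP
  have := h Q hQ _ (mem_conjBy.1 (hx hp))
  simpa [mul_comm] using this

theorem FreeDecomp.exists_hom_of_ne_top [IsFreeGroup F] {𝒮 : Set (Subgroup F)} {B P : Subgroup F}
    (h : FreeDecomp 𝒮 B) (hP : P ∈ 𝒮) (hne : P ≠ ⊤) :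
    ∃ χ : F →* Multiplicative (ZMod 2), (∀ p ∈ P, χ p = 1) ∧ ∃ g, χ g ≠ 1 := by
  have h' := h.subset (Set.singleton_subset_iff.2 hP)
  set D := sSup (𝒮 \ {P}) ⊔ B
  have hD : D ≠ ⊥ := by
    intro hD
    have := h'.sup_eq_top
    rw [hD, sup_bot_eq, sSup_singleton] at this
    exact hne this
  obtain ⟨χ, d, hd⟩ := exists_hom_ne_one_of_ne_bot hD
  obtain ⟨f, hf, hf'⟩ := h'.exists_hom (fun _ => 1) χ
  exact ⟨f, fun p hp => hf ⟨P, rfl⟩ ⟨p, hp⟩, d, by rwa [hf']⟩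

/-- A criterion for `ℬ ⪯ ℬ'` to be an equivalence. -/
theorem FreeDecomp.carries_of_kills [IsFreeGroup F] {ℬ ℬ' : Set (Subgroup F)} {C C' : Subgroup F}
    (h : FreeDecomp ℬ C) (h' : FreeDecomp ℬ' C') (hne : ∀ B ∈ ℬ, B ≠ ⊥) (hne' : ∀ B ∈ ℬ', B ≠ ⊥)
    (hfin : ℬ.Finite) (hcard : ℬ.ncard ≤ ℬ'.ncard) (hc : Carries ℬ' ℬ)
    (hk : ∀ χ : F →* Multiplicative (ZMod 2), Kills χ ℬ → Kills χ ℬ') : Carries ℬ ℬ' := by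
  have hc' : ∀ B : ℬ, ∃ B' : ℬ', ∃ x, (B : Subgroup F) ≤ conjBy x B' := fun B => by
    obtain ⟨B', hB', hx⟩ := hc B B.2
    exact ⟨⟨B', hB'⟩, hx⟩
  choose m x hx using hc'
  have hkill : ∀ (f : F →* Multiplicative (ZMod 2)) (B : ℬ),
      (∀ q ∈ (m B : Subgroup F), f q = 1) → ∀ p ∈ (B : Subgroup F), f p = 1 := by
    intro f B hf p hp
    simpa [mul_comm] using hf _ (mem_conjBy.1 (hx B hp))
  -- A homomorphism detecting only a missed component of `ℬ'` would kill `ℬ` but not `ℬ'`.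
  have hsurj : Function.Surjective m := by
    intro B'
    by_contra! hB'
    obtain ⟨χ, b, hb⟩ := exists_hom_ne_one_of_ne_bot (hne' B' B'.2)
    obtain ⟨f, hf, hf'⟩ := h'.exists_extension B'.2 χ
    apply hb
    rw [← hf]
    refine hk f (fun B hB => hkill f ⟨B, hB⟩ ?_) B' B'.2 b b.2
    exact hf' _ (m ⟨B, hB⟩).2 fun h => hB' ⟨B, hB⟩ (Subtype.ext h)
  have hinj : Function.Injective m := by
    have : Finite ℬ := hfin
    have : Finite ℬ' := Finite.of_surjective m hsurj
    exact (hsurj.bijective_of_nat_card_le hcard).1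
  intro B' hB'
  obtain ⟨B, hB⟩ := hsurj ⟨B', hB'⟩
  refine ⟨B, B.2, (x B)⁻¹, ?_⟩
  have hBle := hx B
  rw [hB] at hBle
  have hcle : conjBy (x B)⁻¹ (B : Subgroup F) ≤ B' := by
    refine (conjBy_mono _ hBle).trans ?_
    rw [conjBy_conjBy, inv_mul_cancel, conjBy_one]
  -- Kurosh inside `B'` makes the conjugate of `B` a free factor of `B'`, up to conjugacy in `B'`.
  obtain ⟨𝒮, D, hD, -, hP⟩ := h.exists_pullback (ψ := B'.subtype) B'.subtype_injective
  have hne0 : (conjBy (x B)⁻¹ (B : Subgroup F)).comap B'.subtype ≠ ⊥ := by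
    intro h0
    apply hne B B.2
    rw [Subgroup.eq_bot_iff_forall] at h0 ⊢
    intro b hb
    have hb' : (x B)⁻¹ * b * x B ∈ conjBy (x B)⁻¹ (B : Subgroup F) := by
      rw [mem_conjBy]
      simpa [mul_assoc] using hb
    have := congrArg Subtype.val (h0 ⟨_, hcle hb'⟩ hb')
    simpa [mul_assoc, inv_mul_eq_one, mul_eq_left] using this
  obtain ⟨P, hPS, l, hl⟩ := hP B B.2 _ hne0
  by_cases hPt : P = ⊤
  · intro b hb
    have : (⟨b, hb⟩ : B') ∈ (conjBy (x B)⁻¹ (B : Subgroup F)).comap B'.subtype := by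
      rw [hl, hPt, mem_conjBy]
      trivial
    exact this
  exfalso
  -- A proper free factor is killed by some nontrivial `χ` on `B'`. Extended by killing the other
  -- components, it kills `ℬ`, as `B` is the only component sent into `B'`, but not `ℬ'`.
  obtain ⟨χ, hχ, g, hg⟩ := hD.exists_hom_of_ne_top hPS hPt
  obtain ⟨f, hf, hf'⟩ := h'.exists_extension hB' χ
  apply hg
  rw [← hf]
  refine hk f (fun B₁ hB₁ => ?_) B' hB' g g.2
  by_cases hBB : m ⟨B₁, hB₁⟩ = ⟨B', hB'⟩
  · obtain rfl : ⟨B₁, hB₁⟩ = B := hinj (hBB.trans hB.symm)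
    intro p hp
    have hp' : (x ⟨B₁, hB₁⟩)⁻¹ * p * x ⟨B₁, hB₁⟩ ∈ conjBy (x ⟨B₁, hB₁⟩)⁻¹ B₁ := by
      rw [mem_conjBy]
      simpa [mul_assoc] using hp
    have h1 : (⟨_, hcle hp'⟩ : B') ∈ (conjBy (x ⟨B₁, hB₁⟩)⁻¹ B₁).comap B'.subtype := hp'
    rw [hl, mem_conjBy] at h1
    have h2 := hχ _ h1
    rw [map_mul, map_mul, map_inv, mul_comm, mul_inv_cancel_left, ← hf] at h2
    simpa [mul_comm] using h2
  · exact hkill f ⟨B₁, hB₁⟩ (hf' _ (m ⟨B₁, hB₁⟩).2 fun h => hBB (Subtype.ext h))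

/-- An ascending chain of free decompositions stabilizes. -/
theorem exists_stable_of_ascending [IsFreeGroup F] [Finite (F →* Multiplicative (ZMod 2))]
    (𝒮 : ℕ → Set (Subgroup F)) (C : ℕ → Subgroup F) (h : ∀ k, FreeDecomp (𝒮 k) (C k))
    (hne : ∀ k, ∀ P ∈ 𝒮 k, P ≠ ⊥) (hc : ∀ k m, k ≤ m → Carries (𝒮 m) (𝒮 k)) :
    ∃ k, ∀ m, Carries (𝒮 k) (𝒮 m) := by
  let V : ℕ → Set (F →* Multiplicative (ZMod 2)) := fun k => {χ | Kills χ (𝒮 k)}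
  have hV : ∀ k m, k ≤ m → V m ⊆ V k := fun k m hkm χ hχ => Kills.of_carries hχ (hc k m hkm)
  let K := Function.argmin fun k => (V k).ncard
  have hK : ∀ m, K ≤ m → V m = V K := fun m hm =>
    Set.eq_of_subset_of_ncard_le (hV K m hm) (Function.argmin_le (fun k => (V k).ncard) m)
      (Set.toFinite _)
  -- From `K` on the killing sets are constant; the least number of components beyond `K` supplies
  -- the cardinality hypothesis.
  let k := (fun k => (𝒮 k).ncard).argminOn (Set.Ici K) ⟨K, Set.mem_Ici.2 le_rfl⟩
  have hkK : K ≤ k := (fun k => (𝒮 k).ncard).argminOn_mem (Set.Ici K) ⟨K, Set.mem_Ici.2 le_rfl⟩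
  have hk : ∀ m, K ≤ m → (𝒮 k).ncard ≤ (𝒮 m).ncard := fun m hm =>
    (fun k => (𝒮 k).ncard).argminOn_le (Set.Ici K) hm
  have hstab : ∀ m, k ≤ m → Carries (𝒮 k) (𝒮 m) := by
    intro m hm
    refine (h k).carries_of_kills (h m) (hne k) (hne m) ((h k).finite (hne k))
      (hk m (hkK.trans hm)) (hc k m hm) fun χ hχ => ?_
    have : V k = V m := (hK k hkK).trans (hK m (hkK.trans hm)).symm
    exact this.le hχ
  exact ⟨k, fun m => (hstab (max k m) (le_max_left _ _)).trans (hc m _ (le_max_right _ _))⟩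

end Chain

/-! ### The elliptic system and its relation to `𝒜`. -/

section Elliptic

variable {F : Type u} [Group F]

/-- The `k`-th iterate of an endomorphism. -/
def iter (φ : F →* F) : ℕ → (F →* F)
  | 0 => MonoidHom.id F
  | k + 1 => φ.comp (iter φ k)

theorem iter_injective {φ : F →* F} (hφ : Function.Injective φ) (k : ℕ) :
    Function.Injective (iter φ k) := by
  induction k with
  | zero => exact Function.injective_id
  | succ k ih => exact hφ.comp ih

theorem iter_add_map (φ : F →* F) (k m : ℕ) (A : Subgroup F) :
    A.map (iter φ (m + k)) = (A.map (iter φ k)).map (iter φ m) := by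
  induction m with
  | zero => simp [iter]
  | succ m ih =>
    rw [Nat.succ_add, iter, ← Subgroup.map_map, ih, Subgroup.map_map, ← iter]

theorem iterate_mapSystem (φ : F →* F) (k : ℕ) (𝒜 : Set (Subgroup F)) :
    (mapSystem φ)^[k] 𝒜 = Subgroup.map (iter φ k) '' 𝒜 := by
  induction k with
  | zero => simp [iter]
  | succ k ih =>
    rw [Function.iterate_succ_apply', ih, mapSystem, Set.image_image]
    simp only [Subgroup.map_map, iter]

theorem IsFixed.exists_map_iter {φ : F →* F} {𝒜 : Set (Subgroup F)} (h : IsFixed φ 𝒜) (k : ℕ) :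
    ∀ A ∈ 𝒜, ∃ A' ∈ 𝒜, ∃ x, A.map (iter φ k) = conjBy x A' := by
  induction k with
  | zero => exact fun A hA => ⟨A, hA, 1, by simp [iter]⟩
  | succ k ih =>
    intro A hA
    obtain ⟨A', hA', x, hx⟩ := ih A hA
    obtain ⟨σ, hσ⟩ := h
    obtain ⟨y, hy⟩ := hσ ⟨A', hA'⟩
    refine ⟨_, (σ ⟨A', hA'⟩).2, φ x * y, ?_⟩
    rw [iter, ← Subgroup.map_map, hx, map_conjBy, hy, conjBy_conjBy]

/-- A system that carries, up to conjugacy, the preimages under `ψ` of the components of `𝒜`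
also carries each subgroup whose image is carried by `𝒜`. -/
theorem exists_le_conjBy_of_map {ψ : F →* F} {𝒜 𝒮 : Set (Subgroup F)} (hne : 𝒮.Nonempty)
    (h : ∀ A ∈ 𝒜, ∀ x, (conjBy x A).comap ψ ≠ ⊥ →
        ∃ P ∈ 𝒮, ∃ l, (conjBy x A).comap ψ = conjBy l P)
    {Q : Subgroup F} (hQ : ∃ A ∈ 𝒜, ∃ x, Q.map ψ ≤ conjBy x A) :
    ∃ P ∈ 𝒮, ∃ l, Q ≤ conjBy l P := by
  obtain ⟨A, hA, x, hx⟩ := hQ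
  have hle := Subgroup.map_le_iff_le_comap.1 hx
  by_cases h0 : (conjBy x A).comap ψ = ⊥
  · obtain ⟨P, hP⟩ := hne
    exact ⟨P, hP, 1, (hle.trans h0.le).trans bot_le⟩
  · obtain ⟨P, hP, l, hl⟩ := h A hA x h0
    exact ⟨P, hP, l, hle.trans hl.le⟩

/-- The greatest eventually carried system, when `𝒜` is nontrivial. -/
theorem exists_greatest_eventuallyCarried [IsFreeGroup F]
    [Finite (F →* Multiplicative (ZMod 2))] {φ : F →* F} (hφ : Function.Injective φ)
    {𝒜 : Set (Subgroup F)} (h𝒜 : IsNontrivialFreeFactorSystem 𝒜) (hfix : IsFixed φ 𝒜) :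
    ∃ ℰ, IsEventuallyCarried φ 𝒜 ℰ ∧ ∀ ℬ, IsEventuallyCarried φ 𝒜 ℬ → Carries ℰ ℬ := by
  obtain ⟨C, hC⟩ := h𝒜.exists_freeDecomp
  choose 𝒮 D hD hS hex using fun k => hC.exists_pullback (iter_injective hφ k)
  have hmap : ∀ k, ∀ P ∈ 𝒮 k, ∃ A ∈ 𝒜, ∃ x, P.map (iter φ k) ≤ conjBy x A := by
    intro k P hP
    obtain ⟨-, A, hA, x, rfl⟩ := hS k P hP
    exact ⟨A, hA, x, Subgroup.map_comap_le _ _⟩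
  have hmap' : ∀ k m, ∀ Q : Subgroup F, (∃ A ∈ 𝒜, ∃ x, Q.map (iter φ k) ≤ conjBy x A) →
      ∃ A ∈ 𝒜, ∃ x, Q.map (iter φ (m + k)) ≤ conjBy x A := by
    rintro k m Q ⟨A, hA, x, hx⟩
    obtain ⟨A', hA', y, hy⟩ := hfix.exists_map_iter m A hA
    refine ⟨A', hA', iter φ m x * y, ?_⟩
    rw [iter_add_map, ← conjBy_conjBy, ← hy, ← map_conjBy]
    exact Subgroup.map_mono hx
  have hA : ∀ k, ∀ A ∈ 𝒜, ∃ A' ∈ 𝒜, ∃ x, A.map (iter φ k) ≤ conjBy x A' := by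
    intro k A hA
    obtain ⟨A', hA', x, hx⟩ := hfix.exists_map_iter k A hA
    exact ⟨A', hA', x, hx.le⟩
  have hnon : ∀ k, (𝒮 k).Nonempty := by
    intro k
    obtain ⟨A, hA0⟩ := h𝒜.nonempty
    obtain ⟨A', hA', x, hx⟩ := hA k A hA0
    have hle := Subgroup.map_le_iff_le_comap.1 hx
    obtain ⟨P, hP, -⟩ := hex k A' hA' x fun h0 => h𝒜.ne_bot A hA0 (le_bot_iff.1 (h0 ▸ hle))
    exact ⟨P, hP⟩
  -- What `φ^k` sends into `𝒜`, any further iterate keeps in `𝒜`, since `𝒜` is fixed.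
  have hasc : ∀ k m, k ≤ m → Carries (𝒮 m) (𝒮 k) := by
    intro k m hkm P hP
    obtain ⟨d, rfl⟩ := Nat.exists_eq_add_of_le' hkm
    exact exists_le_conjBy_of_map (hnon _) (hex _) (hmap' k d P (hmap k P hP))
  obtain ⟨k, hk⟩ := exists_stable_of_ascending 𝒮 D hD (fun k P hP => (hS k P hP).1) hasc
  refine ⟨𝒮 k, ⟨Or.inr ⟨(hD k).finite fun P hP => (hS k P hP).1, hnon k,
    fun P hP => (hS k P hP).1, (hD k).injective_lift, (hD k).isFreeFactor⟩, ?_, ?_, k, ?_⟩, ?_⟩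
  · rintro _ ⟨P, hP, rfl⟩
    refine exists_le_conjBy_of_map (hnon _) (hex _) ?_
    have h1 := hmap' k 1 P (hmap k P hP)
    rw [add_comm, iter_add_map] at h1
    simpa [iter] using h1
  · exact fun A hA0 => exists_le_conjBy_of_map (hnon _) (hex _) (hA k A hA0)
  · rw [iterate_mapSystem]
    rintro _ ⟨P, hP, rfl⟩
    exact hmap k P hP
  · intro ℬ hℬ
    obtain ⟨j, hj⟩ := hℬ.eventually
    rw [iterate_mapSystem] at hj
    -- `𝒮 j` carries `ℬ` for the exponent `j` of `ℬ`, and the stable term carries `𝒮 j`.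
    exact (hk j).trans fun Q hQ =>
      exists_le_conjBy_of_map (hnon _) (hex _) (hj _ ⟨Q, hQ, rfl⟩)

theorem IsEventuallyCarried.eq_singleton_bot {φ : F →* F} (hφ : Function.Injective φ)
    {ℬ : Set (Subgroup F)} (h : IsEventuallyCarried φ {⊥} ℬ) : ℬ = {⊥} := by
  rcases h.system with h0 | h0
  · exact h0
  · exfalso
    obtain ⟨k, hk⟩ := h.eventually
    obtain ⟨B, hB⟩ := h0.nonempty
    rw [iterate_mapSystem] at hk
    obtain ⟨_, rfl, x, hx⟩ := hk _ ⟨B, hB, rfl⟩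
    rw [conjBy_bot, le_bot_iff, Subgroup.map_eq_bot_iff_of_injective _ (iter_injective hφ k)] at hx
    exact h0.ne_bot B hB hx

theorem isEventuallyCarried_singleton_bot (φ : F →* F) : IsEventuallyCarried φ {⊥} {⊥} := by
  refine ⟨Or.inl rfl, ?_, ?_, 0, ?_⟩
  · rintro _ ⟨_, rfl, rfl⟩
    exact ⟨⊥, rfl, 1, by simp⟩
  all_goals
    rintro _ rfl
    exact ⟨⊥, rfl, 1, by simp⟩

/-- An eventually carried system contains conjugates of all components of `𝒜`. -/
theorem IsEventuallyCarried.exists_conjBy_mem {φ : F →* F} (hφ : Function.Injective φ)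
    {𝒜 ℰ : Set (Subgroup F)} (h𝒜 : IsNontrivialFreeFactorSystem 𝒜) (hfix : IsFixed φ 𝒜)
    (h : IsEventuallyCarried φ 𝒜 ℰ) {A : Subgroup F} (hA : A ∈ 𝒜) :
    ∃ x, conjBy x A ∈ ℰ := by
  obtain ⟨C, hC⟩ := h𝒜.exists_freeDecomp
  obtain ⟨k, hk⟩ := h.eventually
  rw [iterate_mapSystem] at hk
  obtain ⟨E, hE, x, hx⟩ := h.carries A hA
  obtain ⟨A₁, hA₁, y, hy⟩ := hfix.exists_map_iter k A hA
  obtain ⟨A₂, hA₂, z, hz⟩ := hk _ ⟨E, hE, rfl⟩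
  have h1 : (conjBy x E).map (iter φ k) ≤ conjBy (iter φ k x * z) A₂ := by
    rw [map_conjBy, ← conjBy_conjBy]
    exact conjBy_mono _ hz
  have h2 : conjBy y A₁ ≤ (conjBy x E).map (iter φ k) := hy ▸ Subgroup.map_mono hx
  have h3 : A₁ ≤ conjBy (y⁻¹ * (iter φ k x * z)) A₂ := by
    have := conjBy_mono y⁻¹ (h2.trans h1)
    rwa [conjBy_conjBy, inv_mul_cancel, conjBy_one, conjBy_conjBy] at this
  -- The inclusion of conjugates is an equality, which collapses the chain `h2`, `h1`.
  have h4 := (hC.eq_of_le_conjBy hA₁ hA₂ (h𝒜.ne_bot _ hA₁) h3).2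
  have h5 : conjBy (iter φ k x * z) A₂ = conjBy y A₁ := by
    rw [← h4, conjBy_conjBy, mul_inv_cancel_left]
  have h6 : A.map (iter φ k) = (conjBy x E).map (iter φ k) :=
    le_antisymm (hy ▸ h2) (hy ▸ h5 ▸ h1)
  have h7 : A = conjBy x E := Subgroup.map_injective (iter_injective hφ k) h6
  exact ⟨x⁻¹, by rwa [h7, conjBy_conjBy, inv_mul_cancel, conjBy_one]⟩

/-- The chosen conjugates form a subcollection of `ℰ`, and `FreeDecomp.subset` makes any nonempty
subcollection a free factor system. -/
theorem IsEventuallyCarried.exists_conjugateReplacement {φ : F →* F} (hφ : Function.Injective φ)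
    {𝒜 ℰ : Set (Subgroup F)} (h𝒜 : IsNontrivialFreeFactorSystem 𝒜) (hfix : IsFixed φ 𝒜)
    (h : IsEventuallyCarried φ 𝒜 ℰ) :
    ∃ 𝒜' : Set (Subgroup F), IsFreeFactorSystem 𝒜' ∧ IsConjugateReplacement 𝒜 𝒜' ∧ 𝒜' ⊆ ℰ := by
  obtain ⟨C, hC⟩ := h𝒜.exists_freeDecomp
  choose x hx using fun A : 𝒜 => h.exists_conjBy_mem hφ h𝒜 hfix A.2
  let f : 𝒜 → Subgroup F := fun A => conjBy (x A) A
  have hinj : Function.Injective f := by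
    intro A B hAB
    have hle : (A : Subgroup F) ≤ conjBy ((x A)⁻¹ * x B) B := by
      rw [← conjBy_conjBy, ← show f A = conjBy (x B) B from hAB, conjBy_conjBy, inv_mul_cancel,
        conjBy_one]
    exact Subtype.ext (hC.eq_of_le_conjBy A.2 B.2 (h𝒜.ne_bot _ A.2) hle).1
  have hne : ∀ A, f A ≠ ⊥ := by
    intro A h0
    apply h𝒜.ne_bot A A.2
    have := congrArg (conjBy (x A)⁻¹) h0
    rwa [conjBy_conjBy, inv_mul_cancel, conjBy_one, conjBy_bot] at this
  have hsub : Set.range f ⊆ ℰ := by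
    rintro _ ⟨A, rfl⟩
    exact hx A
  have : Finite 𝒜 := h𝒜.finite
  have : Nonempty 𝒜 := h𝒜.nonempty.to_subtype
  refine ⟨Set.range f, Or.inr ?_, ⟨Equiv.ofInjective f hinj, fun A => ⟨x A, rfl⟩⟩, hsub⟩
  have hℰ : IsNontrivialFreeFactorSystem ℰ := by
    rcases h.system with h0 | h0
    · obtain ⟨A⟩ := ‹Nonempty 𝒜›
      have := hx A
      rw [h0] at this
      exact absurd this (hne A)
    · exact h0
  obtain ⟨D, hD⟩ := hℰ.exists_freeDecomp
  have hD' := hD.subset hsub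
  exact ⟨Set.finite_range f, Set.range_nonempty f, by rintro _ ⟨A, rfl⟩; exact hne A,
    hD'.injective_lift, hD'.isFreeFactor⟩

end Elliptic

end FreeFactor

theorem mainTheorem6 {F : Type*} [Group F] {n : ℕ} (hn : 2 ≤ n) (b : FreeGroupBasis (Fin n) F)
    (φ : F →* F) (hφ : Function.Injective φ)
    (𝒜 : Set (Subgroup F)) (h𝒜 : IsMaximalFixed φ 𝒜) :
    (∃ ℰ : Set (Subgroup F), IsElliptic φ 𝒜 ℰ ∧
      (∀ ℬ : Set (Subgroup F), IsEventuallyCarried φ 𝒜 ℬ → Carries ℰ ℬ) ∧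
      (∀ ℬ : Set (Subgroup F), IsElliptic φ 𝒜 ℬ → SystemEquiv ℬ ℰ)) ∧
    (∀ ℰ : Set (Subgroup F), IsElliptic φ 𝒜 ℰ →
      ∃ 𝒜' : Set (Subgroup F), IsFreeFactorSystem 𝒜' ∧ IsConjugateReplacement 𝒜 𝒜' ∧
        𝒜' ⊆ ℰ) := by
  have : IsFreeGroup F := b.isFreeGroup
  have := finite_hom b
  constructor
  · obtain ⟨ℰ, hℰ, hmax⟩ : ∃ ℰ, IsEventuallyCarried φ 𝒜 ℰ ∧
        ∀ ℬ, IsEventuallyCarried φ 𝒜 ℬ → Carries ℰ ℬ := by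
      -- For the trivial system, injectivity of the iterates leaves `{⊥}` as the only eventually
      -- carried system.
      rcases h𝒜.system with rfl | h
      · refine ⟨{⊥}, isEventuallyCarried_singleton_bot φ, fun ℬ hℬ => ?_⟩
        obtain rfl := hℬ.eq_singleton_bot hφ
        exact hℬ.carries
      · exact exists_greatest_eventuallyCarried hφ h h𝒜.fixed
    refine ⟨ℰ, ⟨hℰ, fun ℬ hℬ _ => hmax ℬ hℬ⟩, hmax, fun ℬ hℬ => ?_⟩
    have h := hmax ℬ hℬ.eventuallyCarried
    exact ⟨hℬ.maximal ℰ hℰ h, h⟩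
  · intro ℰ hℰ
    rcases h𝒜.system with rfl | h
    · refine ⟨{⊥}, Or.inl rfl, ⟨Equiv.refl _, fun A => ⟨1, by simp⟩⟩, ?_⟩
      rw [hℰ.eventuallyCarried.eq_singleton_bot hφ]
    · exact hℰ.eventuallyCarried.exists_conjugateReplacement hφ h h𝒜.fixed
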